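/- A source is a probability distribution $p=(p_1,\dots,p_n)$ with positive entries $p_1\ge p_2\ge\dots\ge p_n$ on a finite alphabet $\mathcal S$; $H(p)=-\sum_i p_i\log_2 p_i$ is its entropy and $h(u)=-u\log_2u-(1-u)\log_2(1-u)$. Let $T$ be a Huffman code tree of $p$, $L_H$ its average codeword length, and $T_R$, $T_L$ the subtrees at the two children of its root, named so that the total probability $P_R$ of the symbols in $T_R$ is at least $1/2$. An asymmetric encoding-decoding scheme (AEDS) has a finite set of states; in state $\hat x$ it encodes a symbol $s$ by a binary word $E_{\hat x}(s)$ and moves to a state $F^-_{\hat x}(s)$, where for each state $x$ the words $E_{\hat x}(s)$ of the distinct pairs $(\hat x,s)$ with $F^-_{\hat x}(s)=x$ are distinct and prefix-free. Its average code length is $\sum_{\hat x,s}p(s)Q(\hat x)\,|E_{\hat x}(s)|$, where $Q$ is the stationary distribution of the state when the symbols are drawn independently from $p$. Two AEDSs are built on $T$; in both, the codeword of a symbol in $T_R$ (in $T_L$) is a word of extra bits, depending on the state and on the subtree, followed by the codeword of the symbol in that subtree. Type I with $N\ge2$ states $\alpha_1,\dots,\alpha_N$, where $k=\lceil\log_2N\rceil$: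 a symbol in $T_R$ leads from $\alpha_j$ to $\alpha_{j+1}$ with no extra bits if $j<N$, and from $\alpha_N$ to $\alpha_1$ with the extra bit $1$; a symbol in $T_L$ leads from $\alpha_j$ to $\alpha_1$, with the extra bit $0$ followed by the $j$-th word of the phased-in code, a prefix-free code with $2^k-N$ words of $k-1$ bits followed by $2N-2^k$ words of $k$ bits. Type II with five states: a symbol in $T_R$ leads from $\alpha_1,\dots,\alpha_5$ to $\alpha_3,\alpha_3,\alpha_4,\alpha_5,\alpha_3$ with extra bits $0,\ 10,\ \lambda,\ \lambda,\ 11$, and a symbol in $T_L$ leads from $\alpha_1,\dots,\alpha_5$ to $\alpha_2,\alpha_1,\alpha_1,\alpha_1,\alpha_1$ with extra bits $\lambda,\ 110,\ 0,\ 10,\ 111$, where $\lambda$ is the empty word. Let $L_N^{(\mathrm I)}$ and $L^{(\mathrm{II})}$ be the average code lengths of the Type-I and Type-II AEDSs on the Huffman tree, with the convention that the Huffman code itself is used (so that the length is $L_H$) when the AEDS is not shorter. With $[u]_0=\max\{u,0\}$ put $$\delta_N^{(\mathrm I)}(P)=\left[\frac{1-P^{N-1}}{1-P^N}P+\frac{1-P^{2^k-N}}{1-P^N}(1-P)-k(1-P)\right]_0,\qquad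 \delta^{(\mathrm{II})}(P)=\left[\frac{P^3-P^2+2P-1}{(2-P)(1+P+P^2)}\right]_0 .$$ **Corollary.** Let $\tfrac12\le p_1<1$ and $N\ge 2$. For every source with largest probability $p_1$ the reductions in average code length are $L_H-L_N^{(\mathrm I)}=\delta_N^{(\mathrm I)}(p_1)$ and $L_H-L^{(\mathrm{II})}=\delta^{(\mathrm{II})}(p_1)$. The worst-case redundancies $$\mu_H(p_1)=\sup[L_H-H(p)],\quad \mu_N^{(\mathrm I)}(p_1)=\sup[L_N^{(\mathrm I)}-H(p)],\quad \mu^{(\mathrm{II})}(p_1)=\sup[L^{(\mathrm{II})}-H(p)],$$ the suprema being over all sources with largest probability $p_1$, are $$\mu_H(p_1)=2-p_1-h(p_1),\qquad \mu_N^{(\mathrm I)}(p_1)=\mu_H(p_1)-\delta_N^{(\mathrm I)}(p_1),\qquad \mu^{(\mathrm{II})}(p_1)=\mu_H(p_1)-\delta^{(\mathrm{II})}(p_1).$$ The same values are obtained when the suprema are taken over the sources with a fixed number $n\ge3$ of symbols. -/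

import Mathlib

/-! ### Binary code trees -/

/-- Binary code trees whose leaves carry source symbols. -/
inductive CodeTree (S : Type) : Type
  | leaf (s : S) : CodeTree S
  | node (left right : CodeTree S) : CodeTree S

namespace CodeTree

variable {S : Type}

/-- The symbols at the leaves of a tree, with multiplicity. -/
def leaves : CodeTree S → Multiset S
  | leaf s => {s}
  | node l r => leaves l + leaves r

/-- Each symbol of the alphabet sits at exactly one leaf. -/
def IsCodeTree [Fintype S] (T : CodeTree S) : Prop :=
  T.leaves = Finset.univ.val

/-- The codeword of a symbol: the path from the root to its leaf
(`false` is a step to the left, `true` a step to the right). -/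
def code [DecidableEq S] : CodeTree S → S → List Bool
  | leaf _, _ => []
  | node l r, s => if s ∈ r.leaves then true :: code r s else false :: code l s

/-- The probability weight of a tree: the sum of the probabilities of its symbols. -/
def weight (p : S → ℝ) (T : CodeTree S) : ℝ :=
  (T.leaves.map p).sum

/-- The average codeword length of a code tree. -/
def avgLength [Fintype S] [DecidableEq S] (p : S → ℝ) (T : CodeTree S) : ℝ :=
  ∑ s, p s * ((code T s).length : ℝ)

/-- One step of the Huffman algorithm: two trees of smallest weight in the current forest are
joined under a new root. Ties, and which of the two becomes the left child, are arbitrary. -/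
inductive HuffmanStep (p : S → ℝ) : Multiset (CodeTree S) → Multiset (CodeTree S) → Prop
  | merge (t u : CodeTree S) (F : Multiset (CodeTree S))
      (ht : ∀ v ∈ F, weight p t ≤ weight p v) (hu : ∀ v ∈ F, weight p u ≤ weight p v) :
      HuffmanStep p (t ::ₘ u ::ₘ F) (node t u ::ₘ F)

/-- `T` is a Huffman code tree of `p`: it is a possible output of the Huffman algorithm, which
starts from the forest of all single leaves. -/
def IsHuffman [Fintype S] (p : S → ℝ) (T : CodeTree S) : Prop :=
  Relation.ReflTransGen (HuffmanStep p) (Finset.univ.val.map leaf) {T}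

theorem IsHuffman.isCodeTree [Fintype S] {p : S → ℝ} {T : CodeTree S} (h : IsHuffman p T) :
    IsCodeTree T := by
  have key : ∀ F G : Multiset (CodeTree S), Relation.ReflTransGen (HuffmanStep p) F G →
      (F.map leaves).sum = (G.map leaves).sum := by
    intro F G hFG
    induction hFG with
    | refl => rfl
    | tail _ hs ih =>
      rw [ih]
      cases hs
      simp [leaves, add_assoc]
  have h1 := key _ _ h
  have h2 : ∀ m : Multiset S, ((m.map leaf).map leaves).sum = m := by
    intro m
    induction m using Multiset.induction_on with
    | empty => simp
    | cons a m ih =>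
      rw [Multiset.map_cons, Multiset.map_cons, Multiset.sum_cons, ih]
      simp [leaves]
  rw [h2] at h1
  simpa [IsCodeTree] using h1.symm

/-- Codewords of a tree with distinct leaves are prefix-free. -/
theorem code_prefix [DecidableEq S] (T : CodeTree S) (hT : T.leaves.Nodup) {s s' : S}
    (hs : s ∈ T.leaves) (hs' : s' ∈ T.leaves) (h : code T s <+: code T s') : s = s' := by
  induction T with
  | leaf a => simp_all [leaves]
  | node l r ihl ihr =>
    rw [leaves, Multiset.nodup_add] at hT
    simp only [leaves, Multiset.mem_add] at hs hs'
    simp only [code] at h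
    split_ifs at h with h1 h2 h2
    · exact ihr hT.2.1 h1 h2 (by simpa using h)
    · simp at h
    · simp at h
    · exact ihl hT.1 (hs.resolve_right h1) (hs'.resolve_right h2) (by simpa using h)

end CodeTree

/-! ### Asymmetric encoding-decoding schemes -/

/-- An asymmetric encoding-decoding scheme with source alphabet `S` and state set `X`, given by
its encoding functions: in state `x` a symbol `s` is encoded as `enc x s`, and the state becomes
`next x s`. For each state `y`, the codewords `enc x s` of the pairs `(x, s)` with `next x s = y`
are prefix-free and belong to different pairs, so that from `y` the decoder recovers the symbol
`s` and the state `x` instantaneously. -/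
structure AEDS (S X : Type) where
  enc : X → S → List Bool
  next : X → S → X
  prefixFree : ∀ x s x' s', next x s = next x' s' → enc x s <+: enc x' s' → x = x' ∧ s = s'

namespace AEDS

/-- `Q` is a stationary distribution of the Markov chain of the states in encoding, when the
symbols are drawn independently from `p`. -/
def IsStationary {S X : Type} [Fintype S] [Fintype X] [DecidableEq X]
    (A : AEDS S X) (p : S → ℝ) (Q : X → ℝ) : Prop :=
  (∀ x, 0 ≤ Q x) ∧ ∑ x, Q x = 1 ∧
    ∀ y, Q y = ∑ x, ∑ s, if A.next x s = y then p s * Q x else 0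

/-- `L` is the average code length of the scheme: the expected length of a codeword when the
state has the stationary distribution. -/
def HasAvgLength {S X : Type} [Fintype S] [Fintype X] [DecidableEq X]
    (A : AEDS S X) (p : S → ℝ) (L : ℝ) : Prop :=
  ∃ Q : X → ℝ, A.IsStationary p Q ∧ L = ∑ x, ∑ s, p s * Q x * ((A.enc x s).length : ℝ)

/-- The scheme built on a code tree with left subtree `TL` and right subtree `TR`: in state `x`,
the codeword of a symbol in `TR` (`TL`) is `head x true` (`head x false`) followed by the codeword
of the symbol in that subtree, and the next state is `step x true` (`step x false`). -/
def ofTree {S X : Type} [Fintype S] [DecidableEq S] (TL TR : CodeTree S)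
    (hT : (CodeTree.node TL TR).IsCodeTree) (head : X → Bool → List Bool) (step : X → Bool → X)
    (hhead : ∀ x b x' b', step x b = step x' b' → head x b <+: head x' b' → x = x' ∧ b = b') :
    AEDS S X where
  enc x s := if s ∈ TR.leaves then head x true ++ TR.code s else head x false ++ TL.code s
  next x s := if s ∈ TR.leaves then step x true else step x false
  prefixFree := by
    have hnd : (CodeTree.node TL TR).leaves.Nodup := hT ▸ Finset.univ.nodup
    have hmem : ∀ s, s ∈ TL.leaves ∨ s ∈ TR.leaves := by
      intro s
      have : s ∈ (CodeTree.node TL TR).leaves := hT ▸ Finset.mem_univ s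
      simpa [CodeTree.leaves] using this
    rw [CodeTree.leaves, Multiset.nodup_add] at hnd
    have key : ∀ x b x' b' (c c' : List Bool), step x b = step x' b' →
        head x b ++ c <+: head x' b' ++ c' → x = x' ∧ b = b' ∧ c <+: c' := by
      intro x b x' b' c c' hst hpre
      have h1 : head x b <+: head x' b' ++ c' := (List.prefix_append _ _).trans hpre
      have h2 : x = x' ∧ b = b' := by
        rcases List.prefix_or_prefix_of_prefix h1 (List.prefix_append (head x' b') c') with h | h
        · exact hhead _ _ _ _ hst h
        · obtain ⟨e, f⟩ := hhead _ _ _ _ hst.symm h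
          exact ⟨e.symm, f.symm⟩
      obtain ⟨rfl, rfl⟩ := h2
      exact ⟨rfl, rfl, (List.prefix_append_right_inj _).1 hpre⟩
    intro x s x' s' hst hpre
    split_ifs at hst hpre with h1 h2 h2
    · obtain ⟨e, -, h⟩ := key _ _ _ _ _ _ hst hpre
      exact ⟨e, CodeTree.code_prefix TR hnd.2.1 h1 h2 h⟩
    · exact absurd (key _ _ _ _ _ _ hst hpre).2.1 (by decide)
    · exact absurd (key _ _ _ _ _ _ hst hpre).2.1 (by decide)
    · obtain ⟨e, -, h⟩ := key _ _ _ _ _ _ hst hpre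
      exact ⟨e, CodeTree.code_prefix TL hnd.1 ((hmem s).resolve_right h1)
        ((hmem s').resolve_right h2) h⟩

end AEDS

/-! ### The phased-in code -/

/-- The `m`-bit binary representation of `v`, most significant bit first. -/
def toBits : ℕ → ℕ → List Bool
  | 0, _ => []
  | m + 1, v => toBits m (v / 2) ++ [decide (v % 2 = 1)]

theorem toBits_length (m v : ℕ) : (toBits m v).length = m := by
  induction m generalizing v with
  | zero => rfl
  | succ m ih => simp [toBits, ih]

theorem toBits_inj (m : ℕ) {v w : ℕ} (hv : v < 2 ^ m) (hw : w < 2 ^ m)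
    (h : toBits m v = toBits m w) : v = w := by
  induction m generalizing v w with
  | zero => simp at hv hw; omega
  | succ m ih =>
    rw [pow_succ] at hv hw
    have h' := List.append_inj h (by simp [toBits_length])
    have h1 := ih (by omega) (by omega) h'.1
    have h2 : (v % 2 = 1) ↔ (w % 2 = 1) := by simpa using h'.2
    omega

/-- The phased-in code with `N` codewords: with `k = ⌈log₂ N⌉`, the first `2 ^ k - N` codewords
have `k - 1` bits and the other `2 * N - 2 ^ k` codewords have `k` bits. -/
def phasedIn (N i : ℕ) : List Bool :=
  if i < 2 ^ Nat.clog 2 N - N then toBits (Nat.clog 2 N - 1) i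
  else toBits (Nat.clog 2 N) (i + (2 ^ Nat.clog 2 N - N))

theorem phasedIn_prefix {N i j : ℕ} (hN : 2 ≤ N) (hi : i < N) (hj : j < N)
    (h : phasedIn N i <+: phasedIn N j) : i = j := by
  unfold phasedIn at h
  have hk : 0 < Nat.clog 2 N := Nat.clog_pos (by norm_num) hN
  have hle : N ≤ 2 ^ Nat.clog 2 N := Nat.le_pow_clog (by norm_num) N
  have hlt : 2 ^ (Nat.clog 2 N - 1) < N := Nat.pow_pred_clog_lt_self (by norm_num) hN
  generalize Nat.clog 2 N = k at *
  obtain ⟨m, rfl⟩ : ∃ m, k = m + 1 := ⟨k - 1, by omega⟩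
  simp only [Nat.add_sub_cancel] at h hlt
  have hp : 2 ^ (m + 1) = 2 * 2 ^ m := by ring
  split_ifs at h with h1 h2 h2
  · exact toBits_inj m (by omega) (by omega)
      (h.eq_of_length (by simp [toBits_length]))
  · exfalso
    have h3 : toBits m i <+: toBits m ((j + (2 ^ (m + 1) - N)) / 2) :=
      List.prefix_of_prefix_length_le h (List.prefix_append _ _) (by simp [toBits_length])
    have h4 := toBits_inj m (by omega) (by omega)
      (h3.eq_of_length (by simp [toBits_length]))
    omega
  · have := h.length_le
    simp [toBits_length] at this
  · have := toBits_inj (m + 1) (by omega) (by omega)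
      (h.eq_of_length (by simp [toBits_length]))
    omega

/-! ### The Type-I and Type-II schemes

The states `α₁, α₂, …` are numbered from `0`. -/

/-- The Type-I scheme with `N` states. A symbol of the right subtree takes `α_j` to `α_{j+1}`
without extra bits for `j < N`, and takes `α_N` to `α₁` with the extra bit `1`. A symbol of the
left subtree takes each `α_j` to `α₁`, with the extra bit `0` and the `j`-th codeword of the
phased-in code. -/
def typeI {S : Type} [Fintype S] [DecidableEq S] (N : ℕ) (hN : 2 ≤ N) (TL TR : CodeTree S)
    (hT : (CodeTree.node TL TR).IsCodeTree) : AEDS S (Fin N) :=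
  AEDS.ofTree TL TR hT
    (fun j b => if b then (if (j : ℕ) + 1 < N then [] else [true]) else false :: phasedIn N j)
    (fun j b => if h : b = true ∧ (j : ℕ) + 1 < N then ⟨(j : ℕ) + 1, h.2⟩ else ⟨0, by omega⟩)
    (by
      rintro ⟨i, hi⟩ b ⟨j, hj⟩ b' hst hpre
      rcases b with _ | _ <;> rcases b' with _ | _ <;> simp at hst hpre
      · exact ⟨by simpa using phasedIn_prefix hN hi hj hpre, rfl⟩
      · split_ifs at hst hpre <;> simp at hst hpre
      · split_ifs at hst hpre <;> simp at hst hpre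
        omega
      · split_ifs at hst hpre with h1 h2 h2
        · simp at hst
          simp [hst]
        · simp at hst
        · simp at hst
        · simp
          omega)

/-- The extra bits of the Type-II scheme. -/
def typeIIHead : Fin 5 → Bool → List Bool
  | 0, true => [false]
  | 0, false => []
  | 1, true => [true, false]
  | 1, false => [true, true, false]
  | 2, true => []
  | 2, false => [false]
  | 3, true => []
  | 3, false => [true, false]
  | 4, true => [true, true]
  | 4, false => [true, true, true]

/-- The state transitions of the Type-II scheme. -/
def typeIIStep : Fin 5 → Bool → Fin 5
  | 0, true => 2
  | 0, false => 1
  | 1, true => 2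
  | 1, false => 0
  | 2, true => 3
  | 2, false => 0
  | 3, true => 4
  | 3, false => 0
  | 4, true => 2
  | 4, false => 0

/-- The Type-II scheme, with five states. -/
def typeII {S : Type} [Fintype S] [DecidableEq S] (TL TR : CodeTree S)
    (hT : (CodeTree.node TL TR).IsCodeTree) : AEDS S (Fin 5) :=
  AEDS.ofTree TL TR hT typeIIHead typeIIStep (by decide)

/-! ### Entropy, reductions and redundancies -/

/-- The entropy of a source, in bits. -/
noncomputable def entropy {S : Type} [Fintype S] (p : S → ℝ) : ℝ :=
  -∑ s, p s * Real.logb 2 (p s)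

/-- The binary entropy function, in bits. -/
noncomputable def binaryEntropy (u : ℝ) : ℝ :=
  -u * Real.logb 2 u - (1 - u) * Real.logb 2 (1 - u)

/-- The reduction of the Type-I scheme with `N` states; `Nat.clog 2 N` is `⌈log₂ N⌉`. -/
noncomputable def deltaI (N : ℕ) (P : ℝ) : ℝ :=
  max ((1 - P ^ (N - 1)) / (1 - P ^ N) * P
    + (1 - P ^ (2 ^ Nat.clog 2 N - N)) / (1 - P ^ N) * (1 - P)
    - (Nat.clog 2 N : ℝ) * (1 - P)) 0

/-- The reduction of the Type-II scheme. -/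
noncomputable def deltaII (P : ℝ) : ℝ :=
  max ((P ^ 3 - P ^ 2 + 2 * P - 1) / ((2 - P) * (1 + P + P ^ 2))) 0

/-- A source with `n` symbols of positive probability, the largest of which is `p₁`, together
with a Huffman code tree of it whose right subtree has weight at least `1 / 2`. -/
structure HuffmanSource (n : ℕ) (p₁ : ℝ) where
  p : Fin n → ℝ
  pos : ∀ s, 0 < p s
  sum_eq_one : ∑ s, p s = 1
  largest : IsGreatest (Set.range p) p₁
  TL : CodeTree (Fin n)
  TR : CodeTree (Fin n)
  huffman : (CodeTree.node TL TR).IsHuffman p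
  half_le : 1 / 2 ≤ TR.weight p

namespace HuffmanSource

variable {n : ℕ} {p₁ : ℝ}

/-- The average code length of the Huffman code. -/
noncomputable def huffmanLength (X : HuffmanSource n p₁) : ℝ :=
  (CodeTree.node X.TL X.TR).avgLength X.p

/-- `L` is the average code length of the Type-I scheme on the Huffman tree of the source. -/
def TypeILength (X : HuffmanSource n p₁) (N : ℕ) (hN : 2 ≤ N) (L : ℝ) : Prop :=
  (typeI N hN X.TL X.TR X.huffman.isCodeTree).HasAvgLength X.p L

/-- `L` is the average code length of the Type-II scheme on the Huffman tree of the source. -/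
def TypeIILength (X : HuffmanSource n p₁) (L : ℝ) : Prop :=
  (typeII X.TL X.TR X.huffman.isCodeTree).HasAvgLength X.p L

end HuffmanSource

/-- The redundancies of the Huffman code, for the sources with `n` symbols and largest
probability `p₁`. -/
def huffmanRedundancies (n : ℕ) (p₁ : ℝ) : Set ℝ :=
  {r | ∃ X : HuffmanSource n p₁, r = X.huffmanLength - entropy X.p}

/-- The redundancies of the Type-I scheme on the Huffman tree. The Huffman code itself is used
where the scheme is not shorter, hence the minimum. -/
def typeIRedundancies (N : ℕ) (hN : 2 ≤ N) (n : ℕ) (p₁ : ℝ) : Set ℝ :=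
  {r | ∃ (X : HuffmanSource n p₁) (L : ℝ), X.TypeILength N hN L ∧
    r = min X.huffmanLength L - entropy X.p}

/-- The redundancies of the Type-II scheme on the Huffman tree, with the same convention. -/
def typeIIRedundancies (n : ℕ) (p₁ : ℝ) : Set ℝ :=
  {r | ∃ (X : HuffmanSource n p₁) (L : ℝ), X.TypeIILength L ∧
    r = min X.huffmanLength L - entropy X.p}

/-- Gallager's value `2 - p₁ - h(p₁)`. -/
noncomputable def muH (p₁ : ℝ) : ℝ :=
  2 - p₁ - binaryEntropy p₁

/-! A Huffman tree in which some symbol has probability `p₁ ≥ 1/2` has that symbol as a leaf just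
below the root, since this leaf can only be merged in the last step
(`IsHuffman.eq_leaf_or_eq_leaf`). Hence the two root subtrees have weights `p₁` and `1 - p₁`,
whatever the rest of the source.

Both schemes keep the codewords inside the subtrees and replace only the single bit spent at the
root. The expected number of bits replacing it depends on the state chain alone, which is driven by
the weights of the subtrees. Solving the balance equations gives a unique stationary distribution,
so the reduction is a function of `p₁` only (`typeILength_iff`, `typeIILength_iff`). With the
convention of falling back on the Huffman code, the set of redundancies is a translate of the
Huffman one, and its supremum moves by the same amount.

It remains to find `muH`. For the upper bound, the Huffman cost is at most that of any lengths
satisfying Kraft's inequality (`cost_le_of_kraft`). One bit for the symbol of probability `p₁`, and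
one bit plus the Shannon length in the conditional distribution for each other symbol, give `2 - p₁
- h(p₁)`. For the lower bound, with at least three symbols the Huffman length is at least `2 - p₁`,
while the entropy can be brought as close to `h(p₁)` as desired by making all but two probabilities
tiny. -/

namespace CodeTree

/-! ### Average length as a sum of weights of internal nodes. -/

variable {S : Type}

/-- The sum of the weights of the internal nodes. -/
def cost (p : S → ℝ) : CodeTree S → ℝ
  | leaf _ => 0
  | node l r => weight p l + weight p r + cost p l + cost p r

@[simp] theorem weight_leaf (p : S → ℝ) (s : S) : weight p (leaf s) = p s := by
  simp [weight, leaves]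

theorem weight_node (p : S → ℝ) (l r : CodeTree S) :
    weight p (node l r) = weight p l + weight p r := by
  simp [weight, leaves]

theorem weight_pos {p : S → ℝ} (hp : ∀ s, 0 < p s) (T : CodeTree S) : 0 < weight p T := by
  induction T with
  | leaf s => simpa using hp s
  | node l r ihl ihr => rw [weight_node]; exact add_pos ihl ihr

theorem cost_nonneg {p : S → ℝ} (hp : ∀ s, 0 < p s) (T : CodeTree S) : 0 ≤ cost p T := by
  induction T with
  | leaf s => exact le_rfl
  | node l r ihl ihr =>
    have := weight_pos hp l
    have := weight_pos hp r
    simp only [cost]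
    linarith

/-- Each internal node adds one bit to the codeword of every symbol below it, that is, its own
weight to the sum. -/
theorem sum_length_code [DecidableEq S] (p : S → ℝ) (T : CodeTree S) (hT : T.leaves.Nodup) :
    (T.leaves.map fun s => p s * ((code T s).length : ℝ)).sum = cost p T := by
  induction T with
  | leaf s => simp [leaves, code, cost]
  | node l r ihl ihr =>
    rw [leaves, Multiset.nodup_add] at hT
    have hl : ∀ s ∈ l.leaves, p s * ((code (node l r) s).length : ℝ)
        = p s * ((code l s).length : ℝ) + p s := by
      intro s hs
      have : s ∉ r.leaves := fun h => Multiset.disjoint_left.1 hT.2.2 hs h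
      simp [code, this, mul_add]
    have hr : ∀ s ∈ r.leaves, p s * ((code (node l r) s).length : ℝ)
        = p s * ((code r s).length : ℝ) + p s := by
      intro s hs
      simp [code, hs, mul_add]
    rw [leaves, Multiset.map_add, Multiset.sum_add, Multiset.map_congr rfl hl,
      Multiset.map_congr rfl hr, Multiset.sum_map_add, Multiset.sum_map_add, ihl hT.1, ihr hT.2.1]
    simp only [cost, weight]
    ring

theorem IsCodeTree.nodup [Fintype S] {T : CodeTree S} (hT : T.IsCodeTree) : T.leaves.Nodup :=
  hT ▸ Finset.univ.nodup

theorem IsCodeTree.avgLength_eq_cost [Fintype S] [DecidableEq S] {T : CodeTree S}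
    (hT : T.IsCodeTree) (p : S → ℝ) : avgLength p T = cost p T := by
  rw [← sum_length_code p T hT.nodup, hT]
  rfl

theorem IsCodeTree.weight_eq [Fintype S] {T : CodeTree S} (hT : T.IsCodeTree) (p : S → ℝ) :
    weight p T = ∑ s, p s := by
  rw [weight, hT]
  rfl

theorem IsCodeTree.card_leaves [Fintype S] {T : CodeTree S} (hT : T.IsCodeTree) :
    Multiset.card T.leaves = Fintype.card S := by
  rw [hT]
  rfl

/-! ### Optimality of the Huffman algorithm among Kraft-feasible lengths. -/

/-- A Kraft-feasible assignment of lengths can be changed, at no cost, so that two items of least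
weight have equal lengths. -/
theorem exists_equal_lengths {α : Type} (w : α → ℝ) {t u : α} (ht0 : 0 ≤ w t) (hu0 : 0 ≤ w u)
    (d : ℕ) : ∀ (a b : ℕ) (M : Multiset (α × ℕ)), (M.map Prod.snd).sum = d →
      (∀ v ∈ M, w t ≤ w v.1) → (∀ v ∈ M, w u ≤ w v.1) →
      (1 / 2 : ℝ) ^ a + (1 / 2) ^ b + (M.map fun v => (1 / 2 : ℝ) ^ v.2).sum ≤ 1 →
      ∃ (m : ℕ) (M' : Multiset (α × ℕ)), M'.map Prod.fst = M.map Prod.fst ∧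
        (1 / 2 : ℝ) ^ m + (1 / 2) ^ m + (M'.map fun v => (1 / 2 : ℝ) ^ v.2).sum ≤ 1 ∧
        w t * m + w u * m + (M'.map fun v => w v.1 * v.2).sum
          ≤ w t * a + w u * b + (M.map fun v => w v.1 * v.2).sum := by
  induction d using Nat.strong_induction_on with
  | _ d ih =>
  intro a b M hd ht hu hK
  have hpow : ∀ i c : ℕ, i ≤ c → (1 / 2 : ℝ) ^ i = ((2 ^ (c - i) : ℕ) : ℝ) * (1 / 2) ^ c := by
    intro i c hic
    obtain ⟨e, rfl⟩ := Nat.exists_eq_add_of_le hic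
    rw [Nat.add_sub_cancel_left, pow_add]
    push_cast
    rw [mul_left_comm, ← mul_pow]
    norm_num
  -- In units of `2 ^ (-c)` the items of `M` and the first item have integer size, and so does the
  -- whole budget. The second item has positive size, so the budget exceeds the others by at least
  -- one full unit, which leaves room for it at length `c`.
  have hfin : ∀ c e : ℕ, (∀ v ∈ M, v.2 ≤ c) →
      (1 / 2 : ℝ) ^ c + (1 / 2) ^ e + (M.map fun v => (1 / 2 : ℝ) ^ v.2).sum ≤ 1 →
      (1 / 2 : ℝ) ^ c + (1 / 2) ^ c + (M.map fun v => (1 / 2 : ℝ) ^ v.2).sum ≤ 1 := by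
    intro c e hM hK
    have h1 : (M.map fun v => (1 / 2 : ℝ) ^ v.2).sum
        = (((M.map fun v => 2 ^ (c - v.2)).sum : ℕ) : ℝ) * (1 / 2) ^ c := by
      rw [Multiset.map_congr rfl fun v hv => hpow v.2 c (hM v hv), Multiset.sum_map_mul_right]
      simp [Multiset.map_map]
    rw [h1] at hK ⊢
    generalize (M.map fun v => 2 ^ (c - v.2)).sum = q at *
    have h2 : (1 : ℝ) = ((2 ^ c : ℕ) : ℝ) * (1 / 2) ^ c := by
      simp
    have hc : (0 : ℝ) < (1 / 2) ^ c := by positivity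
    have he : (0 : ℝ) < (1 / 2) ^ e := by positivity
    have h3 : ((1 + q : ℕ) : ℝ) < ((2 ^ c : ℕ) : ℝ) := by
      refine lt_of_mul_lt_mul_right ?_ hc.le
      rw [← h2]
      push_cast
      linarith
    have h4 : ((2 + q : ℕ) : ℝ) ≤ ((2 ^ c : ℕ) : ℝ) := by
      have := Nat.cast_lt.1 h3
      exact Nat.cast_le.2 (by omega)
    have h5 := mul_le_mul_of_nonneg_right h4 hc.le
    rw [← h2] at h5
    push_cast at h5
    linarith
  -- An item of `M` longer than `t` or `u` exchanges lengths with it. The item is at least as heavy,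
  -- so the cost does not rise, and the total length in `M` falls, which allows induction. If there
  -- is no such item, the longer of `a` and `b` is cut to the shorter one.
  by_cases hex : ∃ v ∈ M, a < v.2 ∨ b < v.2
  · obtain ⟨⟨v, c⟩, hv, hc⟩ := hex
    obtain ⟨M₀, rfl⟩ := Multiset.exists_cons_of_mem hv
    simp only [Multiset.map_cons, Multiset.sum_cons, Multiset.forall_mem_cons] at *
    rcases hc with hc | hc
    · obtain ⟨m, M', h1, h2, h3⟩ := ih _ (by simp; omega) c b ((v, a) ::ₘ M₀) rfl
        (by simpa using ht) (by simpa using hu) (by simp at hK ⊢; linarith)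
      refine ⟨m, M', by simpa using h1, h2, h3.trans ?_⟩
      have : (a : ℝ) ≤ c := by exact_mod_cast hc.le
      simp only [Multiset.map_cons, Multiset.sum_cons]
      nlinarith [mul_nonneg (sub_nonneg.2 this) (sub_nonneg.2 ht.1)]
    · obtain ⟨m, M', h1, h2, h3⟩ := ih _ (by simp; omega) a c ((v, b) ::ₘ M₀) rfl
        (by simpa using ht) (by simpa using hu) (by simp at hK ⊢; linarith)
      refine ⟨m, M', by simpa using h1, h2, h3.trans ?_⟩
      have : (b : ℝ) ≤ c := by exact_mod_cast hc.le
      simp only [Multiset.map_cons, Multiset.sum_cons]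
      nlinarith [mul_nonneg (sub_nonneg.2 this) (sub_nonneg.2 hu.1)]
  · push Not at hex
    rcases le_total a b with hab | hab
    · refine ⟨a, M, rfl, hfin a b (fun v hv => (hex v hv).1) hK, ?_⟩
      have : (a : ℝ) ≤ b := by exact_mod_cast hab
      have := mul_le_mul_of_nonneg_left this hu0
      linarith
    · refine ⟨b, M, rfl, hfin b a (fun v hv => (hex v hv).2) (by linarith), ?_⟩
      have : (b : ℝ) ≤ a := by exact_mod_cast hab
      have := mul_le_mul_of_nonneg_left this ht0
      linarith

/-- The Huffman algorithm, started from any forest, is at least as good as any Kraft-feasible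
assignment of lengths to the trees of the forest. -/
theorem cost_le_of_kraft {p : S → ℝ} (hp : ∀ s, 0 < p s) {T : CodeTree S}
    {F : Multiset (CodeTree S)} (h : Relation.ReflTransGen (HuffmanStep p) F {T}) :
    ∀ M : Multiset (CodeTree S × ℕ), M.map Prod.fst = F →
      (M.map fun v => (1 / 2 : ℝ) ^ v.2).sum ≤ 1 →
      cost p T ≤ (M.map fun v => weight p v.1 * v.2).sum + (F.map (cost p)).sum := by
  induction h using Relation.ReflTransGen.head_induction_on with
  | refl =>
    intro M hM _
    obtain ⟨⟨t, l⟩, rfl, rfl⟩ := Multiset.map_eq_singleton.1 hM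
    simpa using mul_nonneg (weight_pos hp _).le (Nat.cast_nonneg l)
  | head hs _ ih =>
    intro M hM hK
    obtain ⟨t, u, F, ht, hu⟩ := hs
    obtain ⟨⟨t', a⟩, hv, rfl⟩ := Multiset.mem_map.1 (hM ▸ Multiset.mem_cons_self t _)
    obtain ⟨M, rfl⟩ := Multiset.exists_cons_of_mem hv
    simp only [Multiset.map_cons, Multiset.cons_inj_right] at hM
    obtain ⟨⟨u', b⟩, hv', rfl⟩ := Multiset.mem_map.1 (hM ▸ Multiset.mem_cons_self u _)
    obtain ⟨M, rfl⟩ := Multiset.exists_cons_of_mem hv'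
    simp only [Multiset.map_cons, Multiset.cons_inj_right] at hM
    subst hM
    simp only [Multiset.map_cons, Multiset.sum_cons] at *
    obtain ⟨m, M', h1, h2, h3⟩ := exists_equal_lengths (weight p) (weight_pos hp t').le
      (weight_pos hp u').le _ a b M rfl
      (fun v hv => ht _ (Multiset.mem_map_of_mem _ hv))
      (fun v hv => hu _ (Multiset.mem_map_of_mem _ hv)) (by linarith)
    have hnn : 0 ≤ (M'.map fun v => (1 / 2 : ℝ) ^ v.2).sum :=
      Multiset.sum_nonneg fun x hx => by
        obtain ⟨v, -, rfl⟩ := Multiset.mem_map.1 hx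
        positivity
    -- Two items of length `0` would violate Kraft's inequality. Otherwise the joined tree takes
    -- length one less: its two children then keep the same Kraft sum, and the bit saved on each is
    -- the weight of the new root.
    rcases m with _ | m
    · norm_num at h2
      linarith
    · have := ih ((node t' u', m) ::ₘ M') (by simp [h1])
        (by
          simp only [Multiset.map_cons, Multiset.sum_cons]
          rw [pow_succ] at h2
          linarith)
      simp only [Multiset.map_cons, Multiset.sum_cons, weight_node, cost] at this
      push_cast at h3
      linarith

theorem IsHuffman.cost_le [Fintype S] {p : S → ℝ} (hp : ∀ s, 0 < p s) {T : CodeTree S}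
    (hT : T.IsHuffman p) (l : S → ℕ) (hl : ∑ s, (1 / 2 : ℝ) ^ l s ≤ 1) :
    cost p T ≤ ∑ s, p s * l s := by
  have := cost_le_of_kraft hp hT (Finset.univ.val.map fun s => (leaf s, l s))
    (by simp [Multiset.map_map])
    (by rw [Multiset.map_map]; exact hl)
  simpa [Multiset.map_map, cost] using this

/-! ### Shape and existence of Huffman trees. -/

/-- If a symbol has probability at least `1 / 2`, it is a child of the root of a Huffman tree. -/
theorem IsHuffman.eq_leaf_or_eq_leaf [Fintype S] {p : S → ℝ} (hp : ∀ s, 0 < p s)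
    (hsum : ∑ s, p s = 1) {s : S} (hs : 1 / 2 ≤ p s) {l r : CodeTree S}
    (hT : (node l r).IsHuffman p) : l = leaf s ∨ r = leaf s := by
  have key : ∀ F, Relation.ReflTransGen (HuffmanStep p) (Finset.univ.val.map leaf) F →
      (F.map (weight p)).sum = 1 ∧
        (leaf s ∈ F ∨ ∃ l r, F = {node l r} ∧ (l = leaf s ∨ r = leaf s)) := by
    intro F hF
    induction hF with
    | refl =>
      refine ⟨?_, Or.inl (Multiset.mem_map_of_mem _ (Finset.mem_univ_val s))⟩
      simpa [Multiset.map_map] using hsum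
    | tail _ hstep ih =>
      obtain ⟨t, u, F, ht, hu⟩ := hstep
      obtain ⟨h1, h2⟩ := ih
      -- If `leaf s` is merged with `y` while some `v` remains, minimality gives `v` weight at least
      -- `1 / 2` as well; with the positive weight of `y` the total exceeds `1`.
      have hF0 : ∀ x y : CodeTree S, x = leaf s → (∀ v ∈ F, weight p x ≤ weight p v) →
          weight p x + weight p y + (F.map (weight p)).sum = 1 → F = 0 := by
        rintro x y rfl hx h
        by_contra hne
        obtain ⟨v, hv⟩ := Multiset.exists_mem_of_ne_zero hne
        have h3 := hx v hv
        have h4 : weight p v ≤ (F.map (weight p)).sum :=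
          Multiset.single_le_sum (fun x hx => by
            obtain ⟨v, -, rfl⟩ := Multiset.mem_map.1 hx
            exact (weight_pos hp v).le) _ (Multiset.mem_map_of_mem _ hv)
        have h5 := weight_pos hp y
        rw [weight_leaf] at h h3
        linarith
      simp only [Multiset.map_cons, Multiset.sum_cons, weight_node] at h1 ⊢
      refine ⟨by linarith, ?_⟩
      rcases h2 with h2 | ⟨l, r, h2, -⟩
      · rcases Multiset.mem_cons.1 h2 with h2 | h2
        · exact Or.inr ⟨t, u, by rw [hF0 t u h2.symm ht (by linarith)]; rfl, Or.inl h2.symm⟩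
        · rcases Multiset.mem_cons.1 h2 with h2 | h2
          · exact Or.inr ⟨t, u, by rw [hF0 u t h2.symm hu (by linarith)]; rfl, Or.inr h2.symm⟩
          · exact Or.inl (Multiset.mem_cons_of_mem h2)
      -- A forest of one tree admits no further step.
      · simpa using congrArg Multiset.card h2
  rcases (key _ hT).2 with h | ⟨l', r', h, h'⟩
  · simp at h
  · obtain ⟨rfl, rfl⟩ : l = l' ∧ r = r' := by simpa using h
    exact h'

/-- The Huffman algorithm can be run on every forest with at least two trees so that at the last
step the heavier tree becomes the right child. -/
theorem exists_huffman_of_forest (p : S → ℝ) (n : ℕ) : ∀ F : Multiset (CodeTree S),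
    Multiset.card F = n + 2 → ∃ l r, weight p l ≤ weight p r ∧
      Relation.ReflTransGen (HuffmanStep p) F {node l r} := by
  have hmin : ∀ F : Multiset (CodeTree S), 0 < Multiset.card F →
      ∃ t G, F = t ::ₘ G ∧ ∀ v ∈ G, weight p t ≤ weight p v := by
    classical
    intro F hF
    obtain ⟨t, ht, hmin⟩ := F.toFinset.exists_min_image (weight p)
      (by simpa [Finset.nonempty_iff_ne_empty, Multiset.card_pos] using hF)
    obtain ⟨G, rfl⟩ := Multiset.exists_cons_of_mem (Multiset.mem_toFinset.1 ht)
    exact ⟨t, G, rfl, fun v hv => hmin v (Multiset.mem_toFinset.2 (Multiset.mem_cons_of_mem hv))⟩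
  induction n with
  | zero =>
    intro F hF
    obtain ⟨t, G, rfl, ht⟩ := hmin F (by omega)
    obtain ⟨u, rfl⟩ := Multiset.card_eq_one.1 (by simpa using hF)
    exact ⟨t, u, ht u (by simp), .single (.merge t u 0 (by simp) (by simp))⟩
  | succ n ih =>
    intro F hF
    obtain ⟨t, G, rfl, ht⟩ := hmin F (by omega)
    rw [Multiset.card_cons] at hF
    obtain ⟨u, G, rfl, hu⟩ := hmin G (by omega)
    rw [Multiset.card_cons] at hF
    obtain ⟨l, r, hlr, h⟩ := ih (node t u ::ₘ G) (by rw [Multiset.card_cons]; omega)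
    exact ⟨l, r, hlr, .head (.merge t u G (fun v hv => ht v (Multiset.mem_cons_of_mem hv)) hu) h⟩

theorem exists_isHuffman [Fintype S] (p : S → ℝ) (hS : 2 ≤ Fintype.card S) :
    ∃ l r, weight p l ≤ weight p r ∧ (node l r).IsHuffman p :=
  exists_huffman_of_forest p (Fintype.card S - 2) _ (by
    rw [Multiset.card_map]
    change Fintype.card S = _
    omega)

theorem weight_le_cost {p : S → ℝ} (hp : ∀ s, 0 < p s) {T : CodeTree S}
    (hT : 2 ≤ Multiset.card T.leaves) : weight p T ≤ cost p T := by
  cases T with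
  | leaf s => simp [leaves] at hT
  | node l r =>
    have := cost_nonneg hp l
    have := cost_nonneg hp r
    rw [weight_node, cost]
    linarith

end CodeTree

/-! ### Schemes built on a tree: state chain and average length. -/

open CodeTree

namespace AEDS

variable {S X : Type} [Fintype S] [DecidableEq S] {TL TR : CodeTree S}

theorem sum_ite_mem_leaves (hT : (node TL TR).IsCodeTree) (f g : S → ℝ) :
    ∑ s, (if s ∈ TR.leaves then f s else g s)
      = (TR.leaves.map f).sum + (TL.leaves.map g).sum := by
  have hnd := hT.nodup
  rw [leaves, Multiset.nodup_add] at hnd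
  change ((Finset.univ.val : Multiset S).map _).sum = _
  rw [← hT, leaves, Multiset.map_add, Multiset.sum_add, add_comm]
  congr 2
  · exact Multiset.map_congr rfl fun s hs => if_pos hs
  · exact Multiset.map_congr rfl fun s hs =>
      if_neg fun h => Multiset.disjoint_left.1 hnd.2.2 hs h

/-- The transitions see a symbol only through its subtree, so the chain is driven by a two-valued
source whose probabilities are the subtree weights. -/
theorem ofTree_isStationary_iff [Fintype X] [DecidableEq X] (hT : (node TL TR).IsCodeTree)
    (head : X → Bool → List Bool) (step : X → Bool → X)
    (hhead : ∀ x b x' b', step x b = step x' b' → head x b <+: head x' b' → x = x' ∧ b = b')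
    (p : S → ℝ) (Q : X → ℝ) :
    (ofTree TL TR hT head step hhead).IsStationary p Q ↔
      (∀ x, 0 ≤ Q x) ∧ ∑ x, Q x = 1 ∧ ∀ y, Q y =
        ∑ x, ((if step x true = y then TR.weight p * Q x else 0)
          + if step x false = y then TL.weight p * Q x else 0) := by
  have h : ∀ y x, ∑ s, (if (ofTree TL TR hT head step hhead).next x s = y then p s * Q x else 0)
      = (if step x true = y then TR.weight p * Q x else 0)
          + if step x false = y then TL.weight p * Q x else 0 := by
    intro y x
    have : ∀ s, (if (ofTree TL TR hT head step hhead).next x s = y then p s * Q x else 0)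
        = if s ∈ TR.leaves then (if step x true = y then p s * Q x else 0)
          else (if step x false = y then p s * Q x else 0) := by
      intro s
      by_cases hs : s ∈ TR.leaves <;> simp [ofTree, hs]
    rw [Finset.sum_congr rfl fun s _ => this s, sum_ite_mem_leaves hT]
    congr 1 <;> split_ifs <;> simp [weight, Multiset.sum_map_mul_right]
  simp only [IsStationary, h]

/-- The part of a codeword inside a subtree does not depend on the state and averages to the two
costs, as in the Huffman code. Only the extra bits have to be averaged over the states. -/
theorem ofTree_sum_length [Fintype X] (hT : (node TL TR).IsCodeTree)
    (head : X → Bool → List Bool) (step : X → Bool → X)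
    (hhead : ∀ x b x' b', step x b = step x' b' → head x b <+: head x' b' → x = x' ∧ b = b')
    (p : S → ℝ) {Q : X → ℝ} (hQ : ∑ x, Q x = 1) :
    ∑ x, ∑ s, p s * Q x * (((ofTree TL TR hT head step hhead).enc x s).length : ℝ)
      = TL.cost p + TR.cost p + ∑ x, Q x * (TR.weight p * ((head x true).length : ℝ)
          + TL.weight p * ((head x false).length : ℝ)) := by
  have hnd := hT.nodup
  rw [leaves, Multiset.nodup_add] at hnd
  have h : ∀ x, ∑ s, p s * Q x * (((ofTree TL TR hT head step hhead).enc x s).length : ℝ)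
      = Q x * (TL.cost p + TR.cost p) + Q x * (TR.weight p * ((head x true).length : ℝ)
          + TL.weight p * ((head x false).length : ℝ)) := by
    intro x
    have : ∀ s, p s * Q x * (((ofTree TL TR hT head step hhead).enc x s).length : ℝ)
        = if s ∈ TR.leaves
          then Q x * (p s * ((head x true).length : ℝ) + p s * ((TR.code s).length : ℝ))
          else Q x * (p s * ((head x false).length : ℝ) + p s * ((TL.code s).length : ℝ)) := by
      intro s
      by_cases hs : s ∈ TR.leaves <;> simp [ofTree, hs] <;> ring
    rw [Finset.sum_congr rfl fun s _ => this s, sum_ite_mem_leaves hT]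
    simp only [Multiset.sum_map_mul_left, Multiset.sum_map_mul_right, Multiset.sum_map_add,
      sum_length_code p _ hnd.1, sum_length_code p _ hnd.2.1, weight]
    ring
  rw [Finset.sum_congr rfl fun x _ => h x, Finset.sum_add_distrib, ← Finset.sum_mul, hQ, one_mul]

/-- If the stationary distribution is unique, so is the average code length. -/
theorem ofTree_hasAvgLength_iff [Fintype X] [DecidableEq X] (hT : (node TL TR).IsCodeTree)
    (head : X → Bool → List Bool) (step : X → Bool → X)
    (hhead : ∀ x b x' b', step x b = step x' b' → head x b <+: head x' b' → x = x' ∧ b = b')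
    (p : S → ℝ) (Q : X → ℝ)
    (hQ : ∀ Q', (ofTree TL TR hT head step hhead).IsStationary p Q' ↔ Q' = Q) (L : ℝ) :
    (ofTree TL TR hT head step hhead).HasAvgLength p L ↔
      L = TL.cost p + TR.cost p + ∑ x, Q x * (TR.weight p * ((head x true).length : ℝ)
          + TL.weight p * ((head x false).length : ℝ)) := by
  have h := ofTree_sum_length hT head step hhead p ((hQ Q).2 rfl).2.1
  constructor
  · rintro ⟨Q', hQ', rfl⟩
    rw [(hQ Q').1 hQ', h]
  · intro hL
    exact ⟨Q, (hQ Q).2 rfl, hL.trans h.symm⟩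

end AEDS

/-! ### The Type-I scheme. -/

/-- The probability of the state `α_{j+1}` of the Type-I scheme. -/
noncomputable def typeIStationary (N : ℕ) (P : ℝ) (j : Fin N) : ℝ :=
  P ^ (j : ℕ) * ((1 - P) / (1 - P ^ N))

theorem sum_geometric_stationary {P : ℝ} (hP1 : P < 1) (N M : ℕ) :
    ∑ j ∈ Finset.range M, P ^ j * ((1 - P) / (1 - P ^ N)) = (1 - P ^ M) / (1 - P ^ N) := by
  rw [← Finset.sum_mul, geom_sum_eq hP1.ne, ← neg_div_neg_eq, neg_sub, neg_sub]
  have : 1 - P ≠ 0 := by linarith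
  field_simp

theorem typeI_isStationary_iff {S : Type} [Fintype S] [DecidableEq S] {N : ℕ} (hN : 2 ≤ N)
    {TL TR : CodeTree S} (hT : (node TL TR).IsCodeTree) {p : S → ℝ} {P : ℝ}
    (hR : TR.weight p = P) (hL : TL.weight p = 1 - P) (hP0 : 0 < P) (hP1 : P < 1)
    (Q : Fin N → ℝ) :
    (typeI N hN TL TR hT).IsStationary p Q ↔ Q = typeIStationary N P := by
  obtain ⟨m, rfl⟩ : ∃ m, N = m + 2 := ⟨N - 2, by omega⟩
  have hPN : 0 < 1 - P ^ (m + 2) := sub_pos.2 (pow_lt_one₀ hP0.le hP1 (by omega))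
  have hsum : ∑ x, typeIStationary (m + 2) P x = 1 := by
    rw [← div_self hPN.ne', ← sum_geometric_stationary hP1, ← Fin.sum_univ_eq_sum_range
      (fun j => P ^ j * ((1 - P) / (1 - P ^ (m + 2))))]
    rfl
  rw [typeI, AEDS.ofTree_isStationary_iff, hR, hL]
  -- Every left-subtree symbol resets the chain, so the total mass `1` sends `1 - P` to the first
  -- state. The right-subtree symbols shift the states cyclically. The balance equations are thus a
  -- geometric recursion, with the normalisation fixing `Q 0`.
  have hbal : ∀ Q : Fin (m + 2) → ℝ, ∑ x, Q x = 1 →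
      ((∀ y : Fin (m + 2), Q y = ∑ x : Fin (m + 2),
        ((if (if h : true = true ∧ (x : ℕ) + 1 < m + 2 then (⟨(x : ℕ) + 1, h.2⟩ : Fin (m + 2))
          else ⟨0, by omega⟩) = y then P * Q x else 0)
        + if (if h : false = true ∧ (x : ℕ) + 1 < m + 2 then (⟨(x : ℕ) + 1, h.2⟩ : Fin (m + 2))
          else ⟨0, by omega⟩) = y then (1 - P) * Q x else 0)) ↔
      Q 0 = P * Q (Fin.last _) + (1 - P) ∧ ∀ i : Fin (m + 1), Q i.succ = P * Q i.castSucc) := by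
    intro Q hQ
    rw [Fin.forall_fin_succ]
    have hf : ∀ y : Fin (m + 2), ∑ x : Fin (m + 2), (if (if h : false = true ∧ (x : ℕ) + 1 < m + 2
        then (⟨(x : ℕ) + 1, h.2⟩ : Fin (m + 2)) else ⟨0, by omega⟩) = y then (1 - P) * Q x else 0)
        = if y = 0 then 1 - P else 0 := by
      intro y
      have h0 : ((⟨0, by omega⟩ : Fin (m + 2)) = y) ↔ y = 0 := eq_comm
      simp only [Bool.false_eq_true, false_and, dite_false, h0]
      split_ifs
      · rw [← Finset.mul_sum, hQ, mul_one]
      · simp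
    simp only [Finset.sum_add_distrib, hf]
    have hs : ∀ x : Fin (m + 1), (if h : True ∧ (x.castSucc : ℕ) + 1 < m + 2
        then (⟨(x.castSucc : ℕ) + 1, h.2⟩ : Fin (m + 2)) else ⟨0, by omega⟩) = x.succ :=
      fun x => dif_pos ⟨trivial, by simp [x.is_lt]⟩
    have hl : (if h : True ∧ (Fin.last (m + 1) : ℕ) + 1 < m + 2
        then (⟨(Fin.last (m + 1) : ℕ) + 1, h.2⟩ : Fin (m + 2)) else ⟨0, by omega⟩) = 0 :=
      dif_neg (by simp)
    refine and_congr ?_ (forall_congr' fun i => ?_) <;>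
      rw [Fin.sum_univ_castSucc] <;> simp only [hs, hl]
    · simp
    · simp [(Fin.succ_ne_zero i).symm]
  constructor
  · rintro ⟨-, h1, h2⟩
    rw [hbal Q h1] at h2
    have hpow : ∀ x, Q x = P ^ (x : ℕ) * Q 0 := by
      intro x
      induction x using Fin.induction with
      | zero => simp
      | succ i ih => rw [h2.2, ih, Fin.val_succ, Fin.val_castSucc]; ring
    have h3 := h2.1
    rw [hpow (Fin.last _), Fin.val_last] at h3
    have h4 : Q 0 = (1 - P) / (1 - P ^ (m + 2)) := by
      rw [eq_div_iff hPN.ne']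
      linear_combination h3
    funext x
    rw [hpow, h4]
    rfl
  · rintro rfl
    refine ⟨fun x => ?_, hsum, (hbal _ hsum).2 ⟨?_, fun i => ?_⟩⟩
    · have : 0 < 1 - P := sub_pos.2 hP1
      rw [typeIStationary]
      positivity
    · simp only [typeIStationary, Fin.val_zero, Fin.val_last]
      field_simp
      ring
    · simp only [typeIStationary, Fin.val_succ, Fin.val_castSucc]
      ring

theorem phasedIn_length {N : ℕ} (hN : 2 ≤ N) (j : ℕ) :
    ((phasedIn N j).length : ℝ)
      = (Nat.clog 2 N : ℝ) - if j < 2 ^ Nat.clog 2 N - N then 1 else 0 := by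
  have hk : 1 ≤ Nat.clog 2 N := Nat.clog_pos (by norm_num) hN
  unfold phasedIn
  split_ifs
  · rw [toBits_length, Nat.cast_sub hk, Nat.cast_one]
  · rw [toBits_length, sub_zero]

theorem typeI_extra_bits {N : ℕ} (hN : 2 ≤ N) {P : ℝ} (hP0 : 0 < P) (hP1 : P < 1) :
    ∑ j : Fin N, typeIStationary N P j
      * (P * ((if (j : ℕ) + 1 < N then ([] : List Bool) else [true]).length : ℝ)
        + (1 - P) * ((false :: phasedIn N j).length : ℝ))
      = 1 - ((1 - P ^ (N - 1)) / (1 - P ^ N) * P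
        + (1 - P ^ (2 ^ Nat.clog 2 N - N)) / (1 - P ^ N) * (1 - P)
        - (Nat.clog 2 N : ℝ) * (1 - P)) := by
  have hPN : 0 < 1 - P ^ N := sub_pos.2 (pow_lt_one₀ hP0.le hP1 (by omega))
  set c := (1 - P) / (1 - P ^ N) with hc
  set k := Nat.clog 2 N with hk
  -- There are fewer than `N` short phased-in words, so the sum over the states using them is a
  -- geometric sum with exactly `2 ^ k - N` terms.
  have hlt : 2 ^ k < 2 * N := by
    have h1 : 0 < k := Nat.clog_pos (by norm_num) hN
    have h2 : 2 ^ (k - 1) < N := Nat.pow_pred_clog_lt_self (by norm_num) hN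
    obtain ⟨m, hm⟩ : ∃ m, k = m + 1 := ⟨k - 1, by omega⟩
    rw [hm, Nat.add_sub_cancel] at h2
    rw [hm, pow_succ]
    omega
  have hterm : ∀ j ∈ Finset.range N, P ^ j * c
        * (P * ((if j + 1 < N then ([] : List Bool) else [true]).length : ℝ)
          + (1 - P) * ((false :: phasedIn N j).length : ℝ))
      = (if j = N - 1 then P ^ j * c * P else 0) + (1 - P) * (1 + k) * (P ^ j * c)
        - (1 - P) * (if j < 2 ^ k - N then P ^ j * c else 0) := by
    intro j hj
    have hj := Finset.mem_range.1 hj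
    have h1 : j + 1 < N ↔ ¬ j = N - 1 := by omega
    rw [List.length_cons, Nat.cast_add, phasedIn_length hN]
    simp only [h1, ← hk]
    split_ifs <;> simp <;> ring
  have hfilter : (Finset.range N).filter (fun j => j < 2 ^ k - N) = Finset.range (2 ^ k - N) := by
    ext j
    simp only [Finset.mem_filter, Finset.mem_range]
    omega
  unfold typeIStationary
  rw [Fin.sum_univ_eq_sum_range (fun j => P ^ j * c
    * (P * ((if j + 1 < N then ([] : List Bool) else [true]).length : ℝ)
      + (1 - P) * ((false :: phasedIn N j).length : ℝ))), Finset.sum_congr rfl hterm,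
    Finset.sum_sub_distrib, Finset.sum_add_distrib, ← Finset.mul_sum, ← Finset.mul_sum,
    ← Finset.sum_filter, ← Finset.sum_filter, hfilter, Finset.filter_eq',
    if_pos (Finset.mem_range.2 (by omega)), Finset.sum_singleton,
    sum_geometric_stationary hP1, sum_geometric_stationary hP1, hc, div_self hPN.ne']
  obtain ⟨m, hm⟩ : ∃ m, N = m + 1 := ⟨N - 1, by omega⟩
  have hpow : P ^ N = P ^ (N - 1) * P := by
    rw [hm, Nat.add_sub_cancel, pow_succ]
  rw [hpow] at hPN ⊢
  field_simp
  ring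

/-! ### The Type-II scheme. -/

/-- The stationary distribution of the Type-II scheme. -/
noncomputable def typeIIStationary (P : ℝ) : Fin 5 → ℝ :=
  ![(1 - P) / (2 - P), (1 - P) ^ 2 / (2 - P), P / (1 + P + P ^ 2), P ^ 2 / (1 + P + P ^ 2),
    P ^ 3 / (1 + P + P ^ 2)]

theorem typeII_isStationary_iff {S : Type} [Fintype S] [DecidableEq S]
    {TL TR : CodeTree S} (hT : (node TL TR).IsCodeTree) {p : S → ℝ} {P : ℝ}
    (hR : TR.weight p = P) (hL : TL.weight p = 1 - P) (hP0 : 0 < P) (hP1 : P < 1)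
    (Q : Fin 5 → ℝ) :
    (typeII TL TR hT).IsStationary p Q ↔ Q = typeIIStationary P := by
  have h2 : 0 < 2 - P := by linarith
  have h1 : 0 < 1 - P := by linarith
  have h3 : 0 < 1 + P + P ^ 2 := by positivity
  rw [typeII, AEDS.ofTree_isStationary_iff, hR, hL]
  have hall : ∀ φ : Fin 5 → Prop, (∀ y, φ y) ↔ φ 0 ∧ φ 1 ∧ φ 2 ∧ φ 3 ∧ φ 4 :=
    fun φ => ⟨fun h => ⟨h 0, h 1, h 2, h 3, h 4⟩, fun ⟨h0, h1, h2, h3, h4⟩ y => by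
      fin_cases y <;> assumption⟩
  simp only [hall, Fin.sum_univ_five, typeIIStep, funext_iff, typeIIStationary]
  simp
  constructor
  · rintro ⟨-, hs, e0, e1, e2, e3, e4⟩
    -- A left-subtree symbol leads to the first state from every other state, so `Q 0 = (1 - P) * (1
    -- - Q 0)`.
    have q0 : Q 0 = (1 - P) / (2 - P) := by
      rw [eq_div_iff h2.ne']
      linear_combination e0 + (1 - P) * hs
    have q1 : Q 1 = (1 - P) ^ 2 / (2 - P) := by
      rw [e1, q0]
      ring
    have q2 : Q 2 = P / (1 + P + P ^ 2) := by
      -- Going round the cycle of the last three states gives `Q 2` the factor `1 - P ^ 3 = (1 - P)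
      -- * (1 + P + P ^ 2)`, and `Q 0` brings the denominator `2 - P`; hence the multiplier.
      rw [eq_div_iff h3.ne', ← mul_right_inj' (mul_pos h1 h2).ne']
      rw [e4, e3, e1, q0] at e2
      field_simp at e2
      linear_combination e2
    refine ⟨q0, q1, q2, ?_, ?_⟩
    · rw [e3, q2]
      ring
    · rw [e4, e3, q2]
      ring
  · rintro ⟨q0, q1, q2, q3, q4⟩
    rw [q0, q1, q2, q3, q4]
    refine ⟨⟨by positivity, by positivity, by positivity, by positivity, by positivity⟩,
      ?_, ?_, ?_, ?_, ?_, ?_⟩ <;> field_simp <;> ring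

theorem typeII_extra_bits {P : ℝ} (hP0 : 0 < P) (hP1 : P < 1) :
    ∑ x, typeIIStationary P x * (P * ((typeIIHead x true).length : ℝ)
        + (1 - P) * ((typeIIHead x false).length : ℝ))
      = 1 - (P ^ 3 - P ^ 2 + 2 * P - 1) / ((2 - P) * (1 + P + P ^ 2)) := by
  have h2 : 0 < 2 - P := by linarith
  have h3 : 0 < 1 + P + P ^ 2 := by positivity
  simp [Fin.sum_univ_five, typeIIStationary, typeIIHead]
  field_simp
  ring

/-! ### Lengths and redundancy bounds for a single source. -/

namespace HuffmanSource

variable {n : ℕ} {p₁ : ℝ}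

theorem isCodeTree (X : HuffmanSource n p₁) : (node X.TL X.TR).IsCodeTree :=
  X.huffman.isCodeTree

theorem weight_add_weight (X : HuffmanSource n p₁) : X.TL.weight X.p + X.TR.weight X.p = 1 := by
  rw [← weight_node, X.isCodeTree.weight_eq, X.sum_eq_one]

theorem exists_leaf (X : HuffmanSource n p₁) (hp : 1 / 2 ≤ p₁) :
    ∃ s, X.p s = p₁ ∧ (X.TL = leaf s ∨ X.TR = leaf s) := by
  obtain ⟨s, hs⟩ := X.largest.1
  exact ⟨s, hs, X.huffman.eq_leaf_or_eq_leaf X.pos X.sum_eq_one (hp.trans_eq hs.symm)⟩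

/-- The likeliest symbol may also be the left child, but then both subtrees have weight exactly `1 /
2`. -/
theorem weight_right (X : HuffmanSource n p₁) (hp : 1 / 2 ≤ p₁) : X.TR.weight X.p = p₁ := by
  obtain ⟨s, hs, h | h⟩ := X.exists_leaf hp
  · have h1 := X.weight_add_weight
    have h2 := X.half_le
    rw [h, weight_leaf, hs] at h1
    linarith
  · rw [h, weight_leaf, hs]

theorem weight_left (X : HuffmanSource n p₁) (hp : 1 / 2 ≤ p₁) : X.TL.weight X.p = 1 - p₁ := by
  linarith [X.weight_add_weight, X.weight_right hp]

theorem huffmanLength_eq_cost (X : HuffmanSource n p₁) :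
    X.huffmanLength = (node X.TL X.TR).cost X.p :=
  X.isCodeTree.avgLength_eq_cost X.p

theorem huffmanLength_eq (X : HuffmanSource n p₁) :
    X.huffmanLength = 1 + (X.TL.cost X.p + X.TR.cost X.p) := by
  rw [huffmanLength_eq_cost, cost, X.weight_add_weight, add_assoc]

/-- With at least three symbols, the root child other than the leaf of probability `p₁` is an
internal node, and contributes at least its weight `1 - p₁` beyond the bit of the root. -/
theorem two_sub_le_huffmanLength (X : HuffmanSource n p₁) (hp : 1 / 2 ≤ p₁) (hn : 3 ≤ n) :
    2 - p₁ ≤ X.huffmanLength := by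
  have hcard : Multiset.card X.TL.leaves + Multiset.card X.TR.leaves = n := by
    have := X.isCodeTree.card_leaves
    rwa [leaves, Multiset.card_add, Fintype.card_fin] at this
  rw [huffmanLength_eq]
  have hw := X.weight_add_weight
  obtain ⟨s, hs, h | h⟩ := X.exists_leaf hp
  · rw [h] at hcard hw ⊢
    simp only [leaves, Multiset.card_singleton, weight_leaf, hs, cost] at hcard hw ⊢
    linarith [weight_le_cost X.pos (T := X.TR) (by omega)]
  · rw [h] at hcard hw ⊢
    simp only [leaves, Multiset.card_singleton, weight_leaf, hs, cost] at hcard hw ⊢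
    linarith [weight_le_cost X.pos (T := X.TL) (by omega)]

theorem huffmanLength_sub_entropy_le (X : HuffmanSource n p₁) (hp' : p₁ < 1) :
    X.huffmanLength - entropy X.p ≤ muH p₁ := by
  obtain ⟨s, hs⟩ := X.largest.1
  have hsum : ∀ f : Fin n → ℝ, ∑ i, f i = f s + ∑ i ∈ Finset.univ.erase s, f i :=
    fun f => (Finset.add_sum_erase _ f (Finset.mem_univ s)).symm
  have hp1 : 0 < 1 - p₁ := by linarith
  have hrest : ∑ i ∈ Finset.univ.erase s, X.p i = 1 - p₁ := by
    have := hsum X.p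
    rw [X.sum_eq_one, hs] at this
    linarith
  -- The rounded `a i` is the Shannon length of symbol `i` in the distribution conditioned on not
  -- being `s`. These lengths, increased by one, use at most half of the Kraft budget, and `s` takes
  -- the other half.
  let a : Fin n → ℝ := fun i => Real.logb 2 ((1 - p₁) / X.p i)
  let l : Fin n → ℕ := fun i => if i = s then 1 else 1 + ⌈a i⌉₊
  have hle : ∀ i ∈ Finset.univ.erase s, X.p i ≤ 1 - p₁ := fun i hi =>
    hrest ▸ Finset.single_le_sum (fun j _ => (X.pos j).le) hi
  have ha : ∀ i ∈ Finset.univ.erase s, 0 ≤ a i := fun i hi =>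
    Real.logb_nonneg (by norm_num) ((one_le_div (X.pos i)).2 (hle i hi))
  have hlen : ∀ i ∈ Finset.univ.erase s, l i = 1 + ⌈a i⌉₊ := fun i hi =>
    if_neg (Finset.ne_of_mem_erase hi)
  have hls : l s = 1 := if_pos rfl
  have hkraft : ∑ i, (1 / 2 : ℝ) ^ l i ≤ 1 := by
    have h1 : ∀ i ∈ Finset.univ.erase s, (1 / 2 : ℝ) ^ l i ≤ 1 / 2 * (X.p i / (1 - p₁)) := by
      intro i hi
      rw [hlen i hi, pow_add, pow_one]
      refine mul_le_mul_of_nonneg_left ?_ (by norm_num)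
      have h2 : (1 - p₁) / X.p i ≤ 2 ^ ⌈a i⌉₊ := by
        rw [← Real.rpow_natCast, ← Real.logb_le_iff_le_rpow (by norm_num) (div_pos hp1 (X.pos i))]
        exact Nat.le_ceil _
      rw [one_div, inv_pow, ← inv_div]
      exact inv_anti₀ (div_pos hp1 (X.pos i)) h2
    rw [hsum, hls]
    have h3 := Finset.sum_le_sum h1
    rw [← Finset.mul_sum, ← Finset.sum_div, hrest, div_self hp1.ne'] at h3
    linarith
  have hcost := X.huffman.cost_le X.pos l hkraft
  rw [hsum, hls, hs] at hcost
  have h4 : ∀ i ∈ Finset.univ.erase s, X.p i * (l i : ℝ)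
      ≤ X.p i * (2 + Real.logb 2 (1 - p₁)) - X.p i * Real.logb 2 (X.p i) := by
    intro i hi
    rw [← mul_sub, hlen i hi]
    refine mul_le_mul_of_nonneg_left ?_ (X.pos i).le
    -- Rounding up costs less than one bit per symbol other than `s`. This needs `0 ≤ a i`, because
    -- the natural ceiling truncates at zero.
    have h5 := (Nat.ceil_lt_add_one (ha i hi)).le
    have h6 : a i = Real.logb 2 (1 - p₁) - Real.logb 2 (X.p i) :=
      Real.logb_div hp1.ne' (X.pos i).ne'
    push_cast
    linarith
  have h7 := Finset.sum_le_sum h4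
  rw [Finset.sum_sub_distrib, ← Finset.sum_mul, hrest] at h7
  have h8 : entropy X.p = -(p₁ * Real.logb 2 p₁
      + ∑ i ∈ Finset.univ.erase s, X.p i * Real.logb 2 (X.p i)) := by
    rw [entropy, hsum, hs]
  rw [huffmanLength_eq_cost, h8, muH, binaryEntropy]
  push_cast at hcost
  linarith

theorem typeILength_iff (X : HuffmanSource n p₁) (hp : 1 / 2 ≤ p₁) (hp' : p₁ < 1) {N : ℕ}
    (hN : 2 ≤ N) (L : ℝ) : X.TypeILength N hN L ↔
      L = X.huffmanLength - ((1 - p₁ ^ (N - 1)) / (1 - p₁ ^ N) * p₁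
        + (1 - p₁ ^ (2 ^ Nat.clog 2 N - N)) / (1 - p₁ ^ N) * (1 - p₁)
        - (Nat.clog 2 N : ℝ) * (1 - p₁)) := by
  have hp0 : 0 < p₁ := by linarith
  rw [TypeILength, typeI, AEDS.ofTree_hasAvgLength_iff (Q := typeIStationary N p₁)
    (hQ := typeI_isStationary_iff hN X.isCodeTree (X.weight_right hp) (X.weight_left hp) hp0 hp'),
    X.weight_right hp, X.weight_left hp, huffmanLength_eq]
  have := typeI_extra_bits hN hp0 hp'
  simp only [if_true, Bool.false_eq_true, if_false]
  rw [this]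
  constructor <;> intro h <;> rw [h] <;> ring

theorem typeIILength_iff (X : HuffmanSource n p₁) (hp : 1 / 2 ≤ p₁) (hp' : p₁ < 1) (L : ℝ) :
    X.TypeIILength L ↔ L = X.huffmanLength
      - (p₁ ^ 3 - p₁ ^ 2 + 2 * p₁ - 1) / ((2 - p₁) * (1 + p₁ + p₁ ^ 2)) := by
  have hp0 : 0 < p₁ := by linarith
  rw [TypeIILength, typeII, AEDS.ofTree_hasAvgLength_iff (Q := typeIIStationary p₁)
    (hQ := typeII_isStationary_iff X.isCodeTree (X.weight_right hp) (X.weight_left hp) hp0 hp'),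
    X.weight_right hp, X.weight_left hp, huffmanLength_eq, typeII_extra_bits hp0 hp']
  constructor <;> intro h <;> rw [h] <;> ring

/-- There are sources of any number `m + 3` of symbols, with largest probability `p₁`, whose
entropy is close to `h(p₁)`. -/
theorem exists_entropy_lt (m : ℕ) (hp : 1 / 2 ≤ p₁) (hp' : p₁ < 1) {ε : ℝ} (hε : 0 < ε) :
    ∃ X : HuffmanSource (m + 3) p₁, entropy X.p < binaryEntropy p₁ + ε := by
  -- The mass `1 - p₁` goes almost entirely to one symbol; the `m + 1` remaining ones get `δ` each.
  -- At `δ = 0` this is not a source, but the entropy formula is continuous there, as `0 * logb 2 0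
  -- = 0`, with value `h(p₁)`.
  let q : ℝ → Fin (m + 3) → ℝ := fun δ =>
    Fin.cons p₁ (Fin.cons (1 - p₁ - (m + 1) * δ) fun _ => δ)
  have hent : ∀ δ, entropy (q δ) = -(p₁ * Real.logb 2 p₁
      + ((1 - p₁ - (m + 1) * δ) * Real.logb 2 (1 - p₁ - (m + 1) * δ)
        + (m + 1) * (δ * Real.logb 2 δ))) := by
    intro δ
    simp [entropy, q, Fin.sum_univ_succ (n := m + 2), Fin.sum_univ_succ (n := m + 1)]
  have hcont : Continuous fun x : ℝ => x * Real.logb 2 x := by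
    simp only [Real.logb, ← mul_div_assoc]
    exact Real.continuous_mul_log.div_const _
  have hcont' : Continuous fun δ => entropy (q δ) := by
    simp only [hent]
    have h1 : Continuous fun δ : ℝ => (1 - p₁ - (m + 1) * δ) := by fun_prop
    exact (continuous_const.add ((hcont.comp h1).add (continuous_const.mul hcont))).neg
  have h0 : entropy (q 0) = binaryEntropy p₁ := by
    rw [hent, binaryEntropy]
    simp
    ring
  have hev : ∀ᶠ δ in nhdsWithin (0 : ℝ) (Set.Ioi 0), entropy (q δ) < binaryEntropy p₁ + ε ∧
      0 < δ ∧ δ < (1 - p₁) / (m + 2) := by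
    refine Filter.Eventually.and ?_ (Ioo_mem_nhdsGT (by have : 0 < 1 - p₁ := by linarith
                                                        positivity))
    refine (hcont'.tendsto 0).eventually_lt_const ?_ |>.filter_mono nhdsWithin_le_nhds
    rw [h0]
    linarith
  obtain ⟨δ, hδ, hδ0, hδ1⟩ := hev.exists
  rw [lt_div_iff₀ (by positivity)] at hδ1
  have hmδ : 0 ≤ (m : ℝ) * δ := by positivity
  have hpos : ∀ s, 0 < q δ s := by
    intro s
    refine Fin.cases ?_ (fun s => Fin.cases ?_ (fun s => ?_) s) s <;> simp [q] <;> linarith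
  have hsum : ∑ s, q δ s = 1 := by
    simp [q, Fin.sum_univ_succ (n := m + 2), Fin.sum_univ_succ (n := m + 1)]
  have hmax : IsGreatest (Set.range (q δ)) p₁ := by
    refine ⟨⟨0, rfl⟩, ?_⟩
    rintro _ ⟨s, rfl⟩
    refine Fin.cases ?_ (fun s => Fin.cases ?_ (fun s => ?_) s) s <;> simp [q] <;> linarith
  obtain ⟨l, r, hlr, hT⟩ := exists_isHuffman (q δ) (by simp)
  refine ⟨⟨q δ, hpos, hsum, hmax, l, r, hT, ?_⟩, hδ⟩
  have := hT.isCodeTree.weight_eq (q δ)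
  rw [weight_node, hsum] at this
  linarith

end HuffmanSource

/-! ### Worst-case redundancies. -/

theorem huffmanRedundancies_le {p₁ : ℝ} (hp' : p₁ < 1) (n : ℕ) :
    muH p₁ ∈ upperBounds (huffmanRedundancies n p₁) := by
  rintro _ ⟨X, rfl⟩
  exact X.huffmanLength_sub_entropy_le hp'

theorem isLUB_huffmanRedundancies {p₁ : ℝ} (hp : 1 / 2 ≤ p₁) (hp' : p₁ < 1) {n : ℕ}
    (hn : 3 ≤ n) : IsLUB (huffmanRedundancies n p₁) (muH p₁) := by
  refine ⟨huffmanRedundancies_le hp' n, fun b hb => le_of_forall_pos_le_add fun ε hε => ?_⟩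
  obtain ⟨m, rfl⟩ : ∃ m, n = m + 3 := ⟨n - 3, by omega⟩
  obtain ⟨X, hX⟩ := HuffmanSource.exists_entropy_lt m hp hp' hε
  have h1 := hb ⟨X, rfl⟩
  have h2 := X.two_sub_le_huffmanLength hp hn
  rw [muH]
  linarith

/-- The upper bound holds for every alphabet size, and size `3` alone already approaches it. -/
theorem isLUB_iUnion_huffmanRedundancies {p₁ : ℝ} (hp : 1 / 2 ≤ p₁) (hp' : p₁ < 1) :
    IsLUB (⋃ n, huffmanRedundancies n p₁) (muH p₁) := by
  refine ⟨?_, fun b hb => (isLUB_huffmanRedundancies hp hp' le_rfl).2 fun r hr =>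
    hb (Set.mem_iUnion.2 ⟨3, hr⟩)⟩
  rintro r hr
  obtain ⟨n, hr⟩ := Set.mem_iUnion.1 hr
  exact huffmanRedundancies_le hp' n hr

theorem min_self_sub (a r : ℝ) : min a (a - r) = a - max r 0 := by
  rcases le_total r 0 with h | h
  · rw [max_eq_right h, min_eq_left (by linarith), sub_zero]
  · rw [max_eq_left h, min_eq_right (by linarith)]

theorem isLUB_image_sub {A : Set ℝ} {a : ℝ} (h : IsLUB A a) (d : ℝ) :
    IsLUB ((fun x => x - d) '' A) (a - d) :=
  (OrderIso.subRight d).isLUB_image'.2 h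

/-- The scheme shortens the code by a quantity, possibly negative, that depends only on `N` and
`p₁`; taking the minimum with the Huffman length cuts this quantity off at zero. All redundancies
therefore move by the same constant. -/
theorem typeIRedundancies_eq {p₁ : ℝ} (hp : 1 / 2 ≤ p₁) (hp' : p₁ < 1) {N : ℕ} (hN : 2 ≤ N)
    (n : ℕ) : typeIRedundancies N hN n p₁
      = (fun x => x - deltaI N p₁) '' huffmanRedundancies n p₁ := by
  ext r
  simp only [typeIRedundancies, huffmanRedundancies, Set.mem_ofPred_eq, Set.mem_image,
    HuffmanSource.typeILength_iff _ hp hp', exists_eq_left, min_self_sub, deltaI]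
  constructor
  · rintro ⟨X, rfl⟩
    exact ⟨_, ⟨X, rfl⟩, by ring⟩
  · rintro ⟨_, ⟨X, rfl⟩, rfl⟩
    exact ⟨X, by ring⟩

theorem typeIIRedundancies_eq {p₁ : ℝ} (hp : 1 / 2 ≤ p₁) (hp' : p₁ < 1) (n : ℕ) :
    typeIIRedundancies n p₁ = (fun x => x - deltaII p₁) '' huffmanRedundancies n p₁ := by
  ext r
  simp only [typeIIRedundancies, huffmanRedundancies, Set.mem_ofPred_eq, Set.mem_image,
    HuffmanSource.typeIILength_iff _ hp hp', exists_eq_left, min_self_sub, deltaII]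
  constructor
  · rintro ⟨X, rfl⟩
    exact ⟨_, ⟨X, rfl⟩, by ring⟩
  · rintro ⟨_, ⟨X, rfl⟩, rfl⟩
    exact ⟨X, by ring⟩

theorem corollary2 (p₁ : ℝ) (hp : 1 / 2 ≤ p₁) (hp' : p₁ < 1) :
    -- worst-case redundancy of the Huffman code
    ((∀ n : ℕ, 3 ≤ n → IsLUB (huffmanRedundancies n p₁) (muH p₁)) ∧
      IsLUB (⋃ n, huffmanRedundancies n p₁) (muH p₁)) ∧
    -- the Type-I scheme with `N` states
    (∀ (N : ℕ) (hN : 2 ≤ N),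
      (∀ (n : ℕ) (X : HuffmanSource n p₁),
        ∃ L, (∀ L', X.TypeILength N hN L' ↔ L' = L) ∧
          max (X.huffmanLength - L) 0 = deltaI N p₁) ∧
      (∀ n : ℕ, 3 ≤ n → IsLUB (typeIRedundancies N hN n p₁) (muH p₁ - deltaI N p₁)) ∧
      IsLUB (⋃ n, typeIRedundancies N hN n p₁) (muH p₁ - deltaI N p₁)) ∧
    -- the Type-II scheme
    ((∀ (n : ℕ) (X : HuffmanSource n p₁),
        ∃ L, (∀ L', X.TypeIILength L' ↔ L' = L) ∧
          max (X.huffmanLength - L) 0 = deltaII p₁) ∧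
      (∀ n : ℕ, 3 ≤ n → IsLUB (typeIIRedundancies n p₁) (muH p₁ - deltaII p₁)) ∧
      IsLUB (⋃ n, typeIIRedundancies n p₁) (muH p₁ - deltaII p₁)) := by
  refine ⟨⟨fun n hn => isLUB_huffmanRedundancies hp hp' hn,
    isLUB_iUnion_huffmanRedundancies hp hp'⟩, fun N hN => ⟨fun n X => ?_, fun n hn => ?_, ?_⟩,
    fun n X => ?_, fun n hn => ?_, ?_⟩
  · exact ⟨_, X.typeILength_iff hp hp' hN, by rw [sub_sub_cancel, deltaI]⟩
  · rw [typeIRedundancies_eq hp hp' hN]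
    exact isLUB_image_sub (isLUB_huffmanRedundancies hp hp' hn) _
  · simp only [typeIRedundancies_eq hp hp' hN, ← Set.image_iUnion]
    exact isLUB_image_sub (isLUB_iUnion_huffmanRedundancies hp hp') _
  · exact ⟨_, X.typeIILength_iff hp hp', by rw [sub_sub_cancel, deltaII]⟩
  · rw [typeIIRedundancies_eq hp hp']
    exact isLUB_image_sub (isLUB_huffmanRedundancies hp hp' hn) _
  · simp only [typeIIRedundancies_eq hp hp', ← Set.image_iUnion]
    exact isLUB_image_sub (isLUB_iUnion_huffmanRedundancies hp hp') _
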